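/- Let $R$ be a commutative Noetherian ring and let $\Phi$ be a system of ideals of $R$, that is, a non-empty set of ideals such that for all $\mathfrak a_1,\mathfrak a_2\in\Phi$ there is $\mathfrak b\in\Phi$ with $\mathfrak b\subseteq\mathfrak a_1\mathfrak a_2$. For an $R$-module $M$ put $\Gamma_\Phi(M)=\{x\in M : \mathfrak a x=0 \text{ for some } \mathfrak a\in\Phi\}$, let $H^i_\Phi$ be the $i$-th right derived functor of $\Gamma_\Phi$, and for an ideal $\mathfrak a$ let $H^i_{\mathfrak a}(M)=\varinjlim_n \operatorname{Ext}^i_R(R/\mathfrak a^n,M)$. Let $\mathcal S$ be a Serre subcategory of the category of $R$-modules (a class of modules containing $0$ and closed under submodules, quotients and extensions) that is a Melkersson subcategory with respect to every $\mathfrak a\in\Phi$, that is: for every $\mathfrak a\in\Phi$ and every $R$-module $X$ each of whose elements is annihilated by some power of $\mathfrak a$, if $(0:_X\mathfrak a)\in\mathcal S$, then $X\in\mathcal S$. Let $M$ be an arbitrary $R$-module and $t$ a non-negative integer. (1) Let $\mathfrak a\in\Phi$ and let $N$ be a finitely generated $R$-module with $\operatorname{Supp}_R N=V(\mathfrak a)$.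 If $\operatorname{Ext}^j_R(N,H^i_\Phi(M))\in\mathcal S$ for all $i<t$ and all $j<t-i$, then $H^i_{\mathfrak a}(M)\in\mathcal S$ for all $i<t$. (2) In particular, if $H^i_\Phi(M)\in\mathcal S$ for all $i<t$, then $H^i_{\mathfrak a}(M)\in\mathcal S$ for all $i<t$ and all $\mathfrak a\in\Phi$. -/

import Mathlib

open CategoryTheory

universe u

/-- A system of ideals of `R`: a non-empty set `Φ` of ideals such that for all `a₁, a₂ ∈ Φ` there
is `b ∈ Φ` with `b ⊆ a₁ a₂`. -/
structure IdealSystem (R : Type u) [CommRing R] where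
  carrier : Set (Ideal R)
  nonempty : carrier.Nonempty
  exists_le_mul : ∀ a₁ ∈ carrier, ∀ a₂ ∈ carrier, ∃ b ∈ carrier, b ≤ a₁ * a₂

namespace IdealSystem

variable {R : Type u} [CommRing R]

instance : Membership (Ideal R) (IdealSystem R) := ⟨fun Φ a => a ∈ Φ.carrier⟩

/-- `Γ_Φ(M) = {x ∈ M | a x = 0 for some a ∈ Φ}`, as a submodule of `M`. -/
def torsion (Φ : IdealSystem R) (M : Type u) [AddCommGroup M] [Module R M] : Submodule R M where
  carrier := {x | ∃ a ∈ Φ, ∀ r ∈ a, r • x = 0}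
  zero_mem' := by
    obtain ⟨a, ha⟩ := Φ.nonempty
    exact ⟨a, ha, fun r _ => smul_zero r⟩
  add_mem' := by
    rintro x y ⟨a, ha, hx⟩ ⟨b, hb, hy⟩
    obtain ⟨c, hc, hle⟩ := Φ.exists_le_mul a ha b hb
    refine ⟨c, hc, fun r hr => ?_⟩
    have h₁ : r • x = 0 := hx r (Ideal.mul_le_left (hle hr))
    have h₂ : r • y = 0 := hy r (Ideal.mul_le_right (hle hr))
    rw [smul_add, h₁, h₂, add_zero]
  smul_mem' := by
    rintro s x ⟨a, ha, hx⟩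
    refine ⟨a, ha, fun r hr => ?_⟩
    rw [smul_comm, hx r hr, smul_zero]

theorem map_mem_torsion (Φ : IdealSystem R) {M N : Type u} [AddCommGroup M] [Module R M]
    [AddCommGroup N] [Module R N] (f : M →ₗ[R] N) (x : M) (hx : x ∈ Φ.torsion M) :
    f x ∈ Φ.torsion N := by
  obtain ⟨a, ha, h⟩ := hx
  refine ⟨a, ha, fun r hr => ?_⟩
  rw [← map_smul, h r hr, map_zero]

/-- The functor `Γ_Φ` from the category of `R`-modules to itself; on morphisms it is restriction. -/
def torsionFunctor (Φ : IdealSystem R) : ModuleCat.{u} R ⥤ ModuleCat.{u} R where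
  obj M := ModuleCat.of R (Φ.torsion M)
  map f := ModuleCat.ofHom (f.hom.restrict (Φ.map_mem_torsion f.hom))

instance (Φ : IdealSystem R) : Φ.torsionFunctor.Additive where
  map_add := rfl

/-- The general local cohomology functor `H^i_Φ`, the `i`-th right derived functor of `Γ_Φ`. -/
noncomputable def localCohomology (Φ : IdealSystem R) (i : ℕ) :
    ModuleCat.{u} R ⥤ ModuleCat.{u} R :=
  Φ.torsionFunctor.rightDerived i

end IdealSystem

/-- The class `S` of `R`-modules satisfies the Melkersson condition with respect to the ideal `a`:
for every `a`-torsion module `M` (each element is killed by a power of `a`), if `(0 :_M a)` is in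
`S` then `M` is in `S`. -/
def IsMelkersson {R : Type u} [CommRing R] (S : ObjectProperty (ModuleCat.{u} R))
    (a : Ideal R) : Prop :=
  ∀ M : ModuleCat.{u} R, (∀ x : M, ∃ n : ℕ, ∀ r ∈ a ^ n, r • x = 0) →
    S (ModuleCat.of R (Submodule.torsionBySet R M (a : Set R))) → S M

/-! Three passages lead from `H^i_Φ(M)` to `H^i_a(M)`.

From `H_Φ` to `Ext(N, M)`: let `I` be an injective resolution of `M` and `J = Γ_Φ(I)`. By Artin-Rees
`J` consists of injectives, and its cohomology is `H^i_Φ(M)`. If `N` is killed by a member of `Φ`,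
every map from `N` to `I` lands in `J`. This would give a spectral sequence `Ext^p(N, H^q_Φ(M)) ⇒
Ext^{p+q}(N, M)`; instead, dimension shifting along `0 → Z^i → J^i → Z^{i+1} → H^{i+1} → 0` and a
comparison with the cycles of `I` give `Ext^i(N, M) ∈ S` for `i < t`
(`prop_ext_of_prop_ext_localCohomology`).

From `N` to `R ⧸ a`: membership of `Ext^i(N, M)` in `S` for all `i < t` passes to every finitely
generated module with support inside `Supp N`, by prime filtrations and Noetherian induction on
primes (`prop_ext_of_support_subset`).

From `Ext(R ⧸ a, M)` to `H_a(M)`: the Melkersson condition gives `Γ_a(M) ∈ S`. Then `M ⧸ Γ_a(M)`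
embeds in an injective without `a`-torsion, on which all `Ext^j(R ⧸ a, -)` vanish, and passing to
the cokernel lowers the degree by one (`prop_extLimit`).

This last passage uses direct limits of `Abelian.Ext`, while `localCohomology` is built from derived
functors of `Hom(-, M)`. As `S` is closed under quotients, a surjection from the former onto the
latter suffices. -/

namespace CategoryTheory.ObjectProperty

variable {R : Type u} [CommRing R] (S : ObjectProperty (ModuleCat.{u} R)) [S.IsSerreClass]

/-! ### Serre classes and the long exact sequences of `Ext` -/

section LinearMap

variable {A B D X : Type u} [AddCommGroup A] [Module R A] [AddCommGroup B] [Module R B]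
  [AddCommGroup D] [Module R D] [AddCommGroup X] [Module R X]

lemma prop_of_injective (f : A →ₗ[R] B) (hf : Function.Injective f)
    (h : S (ModuleCat.of R B)) : S (ModuleCat.of R A) := by
  have : Mono (ModuleCat.ofHom f) := (ModuleCat.mono_iff_injective _).2 hf
  exact S.prop_of_mono (ModuleCat.ofHom f) h

lemma prop_of_surjective (f : A →ₗ[R] B) (hf : Function.Surjective f)
    (h : S (ModuleCat.of R A)) : S (ModuleCat.of R B) := by
  have : Epi (ModuleCat.ofHom f) := (ModuleCat.epi_iff_surjective _).2 hf
  exact S.prop_of_epi (ModuleCat.ofHom f) h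

lemma prop_of_subsingleton [Subsingleton A] : S (ModuleCat.of R A) :=
  S.prop_of_isZero (ModuleCat.isZero_of_subsingleton _)

/-- If `D` surjects onto `X` in such a way that the kernel of `D → B` is carried into the range
of `A → X`, then `X` lies in every Serre class containing `A` and `B`. -/
lemma prop_of_surjective_of_ker_le (φ : A →ₗ[R] X) (σ : D →ₗ[R] X) (π : D →ₗ[R] B)
    (hσ : Function.Surjective σ) (h : ∀ d, π d = 0 → ∃ a, φ a = σ d)
    (hA : S (ModuleCat.of R A)) (hB : S (ModuleCat.of R B)) : S (ModuleCat.of R X) := by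
  -- `X` is an extension of `X ⧸ range φ` by `range φ`: the latter is a quotient of `A`, the former
  -- a quotient of `D ⧸ ker π`, which embeds in `B`.
  have h₁ : S (ModuleCat.of R (LinearMap.range φ)) :=
    S.prop_of_surjective φ.rangeRestrict φ.surjective_rangeRestrict hA
  have h₂ : S (ModuleCat.of R (D ⧸ LinearMap.ker π)) :=
    S.prop_of_injective ((LinearMap.ker π).liftQ π le_rfl)
      (LinearMap.ker_eq_bot.1 (Submodule.ker_liftQ_eq_bot _ _ _ le_rfl)) hB
  have h₃ : S (ModuleCat.of R (X ⧸ LinearMap.range φ)) := by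
    refine S.prop_of_surjective
      ((LinearMap.ker π).mapQ (LinearMap.range φ) σ fun d hd => h d hd) ?_ h₂
    intro x
    obtain ⟨x, rfl⟩ := Submodule.mkQ_surjective _ x
    obtain ⟨d, rfl⟩ := hσ x
    exact ⟨Submodule.Quotient.mk d, rfl⟩
  let T := ShortComplex.mk (ModuleCat.ofHom (LinearMap.range φ).subtype)
    (ModuleCat.ofHom (LinearMap.range φ).mkQ) (by ext x; simp)
  have hT : T.Exact := by
    rw [ShortComplex.moduleCat_exact_iff]
    intro x hx
    exact ⟨⟨x, (Submodule.Quotient.mk_eq_zero _).1 hx⟩, rfl⟩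
  exact S.prop_X₂_of_exact hT h₁ h₃

/-- The form in which long exact sequences are used: of exactness at `X`, only `ker g ≤ range f`
matters. -/
lemma prop_of_ker_le (f : A →ₗ[R] X) (g : X →ₗ[R] B) (h : ∀ x, g x = 0 → ∃ a, f a = x)
    (hA : S (ModuleCat.of R A)) (hB : S (ModuleCat.of R B)) : S (ModuleCat.of R X) :=
  S.prop_of_surjective_of_ker_le f LinearMap.id g Function.surjective_id h hA hB

lemma prop_fin_fun (h : S (ModuleCat.of R A)) (n : ℕ) : S (ModuleCat.of R (Fin n → A)) := by
  induction n with
  | zero => exact S.prop_of_subsingleton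
  | succ n ih =>
    refine S.prop_of_ker_le (LinearMap.pi fun i : Fin (n + 1) =>
      Fin.cases (motive := fun _ => (Fin n → A) →ₗ[R] A) 0 (fun i => LinearMap.proj i) i)
      (LinearMap.proj 0) (fun x hx => ⟨fun i => x i.succ, ?_⟩) ih h
    funext i
    refine Fin.cases ?_ (fun i => ?_) i
    · simpa using hx.symm
    · simp

end LinearMap

section Ext

variable {T : ShortComplex (ModuleCat.{u} R)} (hT : T.ShortExact) (N : ModuleCat.{u} R)

include hT

lemma prop_ext_X₁ (j : ℕ) (h₃ : S (ModuleCat.of R (Abelian.Ext N T.X₃ j)))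
    (h₂ : S (ModuleCat.of R (Abelian.Ext N T.X₂ (j + 1)))) :
    S (ModuleCat.of R (Abelian.Ext N T.X₁ (j + 1))) :=
  S.prop_of_ker_le (hT.extClass.postcompOfLinear R N rfl)
    ((Abelian.Ext.mk₀ T.f).postcompOfLinear R N (add_zero _))
    (fun x hx => Abelian.Ext.covariant_sequence_exact₁ N hT x hx rfl) h₃ h₂

lemma prop_ext_X₂ (j : ℕ) (h₁ : S (ModuleCat.of R (Abelian.Ext N T.X₁ j)))
    (h₃ : S (ModuleCat.of R (Abelian.Ext N T.X₃ j))) :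
    S (ModuleCat.of R (Abelian.Ext N T.X₂ j)) :=
  S.prop_of_ker_le ((Abelian.Ext.mk₀ T.f).postcompOfLinear R N (add_zero _))
    ((Abelian.Ext.mk₀ T.g).postcompOfLinear R N (add_zero _))
    (fun x hx => Abelian.Ext.covariant_sequence_exact₂ N hT x hx) h₁ h₃

lemma prop_ext_X₃ (j : ℕ) (h₂ : S (ModuleCat.of R (Abelian.Ext N T.X₂ j)))
    (h₁ : S (ModuleCat.of R (Abelian.Ext N T.X₁ (j + 1)))) :
    S (ModuleCat.of R (Abelian.Ext N T.X₃ j)) :=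
  S.prop_of_ker_le ((Abelian.Ext.mk₀ T.g).postcompOfLinear R N (add_zero _))
    (hT.extClass.postcompOfLinear R N rfl)
    (fun x hx => Abelian.Ext.covariant_sequence_exact₃ N hT x rfl hx) h₂ h₁

lemma prop_ext_X₁_of_injective [Injective T.X₂] (j : ℕ)
    (h₃ : S (ModuleCat.of R (Abelian.Ext N T.X₃ j))) :
    S (ModuleCat.of R (Abelian.Ext N T.X₁ (j + 1))) :=
  have := Abelian.Ext.subsingleton_of_injective N T.X₂ j
  S.prop_ext_X₁ hT N j h₃ S.prop_of_subsingleton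

lemma prop_ext_X₃_of_injective [Injective T.X₂] (j : ℕ)
    (h₁ : S (ModuleCat.of R (Abelian.Ext N T.X₁ (j + 2)))) :
    S (ModuleCat.of R (Abelian.Ext N T.X₃ (j + 1))) :=
  have := Abelian.Ext.subsingleton_of_injective N T.X₂ j
  S.prop_ext_X₃ hT N (j + 1) S.prop_of_subsingleton h₁

lemma prop_ext_contravariant_X₂ (M : ModuleCat.{u} R) (j : ℕ)
    (h₁ : S (ModuleCat.of R (Abelian.Ext T.X₁ M j)))
    (h₃ : S (ModuleCat.of R (Abelian.Ext T.X₃ M j))) :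
    S (ModuleCat.of R (Abelian.Ext T.X₂ M j)) :=
  S.prop_of_ker_le ((Abelian.Ext.mk₀ T.g).precompOfLinear R M (zero_add _))
    ((Abelian.Ext.mk₀ T.f).precompOfLinear R M (zero_add _))
    (fun x hx => Abelian.Ext.contravariant_sequence_exact₂ hT M x hx) h₃ h₁

lemma prop_ext_contravariant_X₃ (M : ModuleCat.{u} R) (j : ℕ)
    (h₁ : S (ModuleCat.of R (Abelian.Ext T.X₁ M j)))
    (h₂ : S (ModuleCat.of R (Abelian.Ext T.X₂ M (j + 1)))) :
    S (ModuleCat.of R (Abelian.Ext T.X₃ M (j + 1))) :=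
  S.prop_of_ker_le (hT.extClass.precompOfLinear R M (add_comm 1 j))
    ((Abelian.Ext.mk₀ T.g).precompOfLinear R M (zero_add _))
    (fun x hx => Abelian.Ext.contravariant_sequence_exact₃ hT M x hx (add_comm 1 j)) h₁ h₂

end Ext

lemma prop_ext_contravariant_X₃_zero (M : ModuleCat.{u} R) {N N' : ModuleCat.{u} R} (f : N ⟶ N')
    [Epi f] (h : S (ModuleCat.of R (Abelian.Ext N M 0))) :
    S (ModuleCat.of R (Abelian.Ext N' M 0)) :=
  S.prop_of_injective ((Abelian.Ext.mk₀ f).precompOfLinear R M (zero_add _))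
    (Abelian.Ext.precomp_mk₀_injective_of_epi M f) h

lemma prop_ext_of_iso {X Y : ModuleCat.{u} R} (e : X ≅ Y) (N : ModuleCat.{u} R) (j : ℕ)
    (h : S (ModuleCat.of R (Abelian.Ext N X j))) : S (ModuleCat.of R (Abelian.Ext N Y j)) := by
  refine S.prop_of_surjective
    ((Abelian.Ext.mk₀ e.hom).postcompOfLinear R N (add_zero _)) (fun x => ?_) h
  exact ⟨x.comp (Abelian.Ext.mk₀ e.inv) (add_zero _), by simp⟩

lemma prop_ext_contravariant_of_iso {X Y : ModuleCat.{u} R} (e : X ≅ Y) (M : ModuleCat.{u} R)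
    (j : ℕ) (h : S (ModuleCat.of R (Abelian.Ext Y M j))) :
    S (ModuleCat.of R (Abelian.Ext X M j)) := by
  refine S.prop_of_surjective
    ((Abelian.Ext.mk₀ e.hom).precompOfLinear R M (zero_add _)) (fun x => ?_) h
  exact ⟨(Abelian.Ext.mk₀ e.inv).comp x (zero_add _), by simp⟩

/-- `Ext` from a finitely generated module into a module of a Serre class stays in that class. -/
lemma prop_ext_of_finite [IsNoetherianRing R] (N X : ModuleCat.{u} R) [Module.Finite R N]
    (h : S X) (j : ℕ) : S (ModuleCat.of R (Abelian.Ext N X j)) := by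
  induction j generalizing N with
  | zero =>
    obtain ⟨n, f, hf⟩ := Module.Finite.exists_fin' R N
    -- A map out of `N` is determined by its values on `n` generators, so `Hom(N, X)` embeds in `X ^
    -- n`.
    refine S.prop_of_injective (B := Fin n → X)
      ((LinearMap.pi fun i => LinearMap.applyₗ (f (Pi.single i 1))) ∘ₗ
        (Abelian.Ext.linearEquiv₀.trans ModuleCat.homLinearEquiv).toLinearMap) ?_ (S.prop_fin_fun h n)
    rw [LinearMap.coe_comp]
    refine Function.Injective.comp ?_ (LinearEquiv.injective _)
    intro g g' hg
    have : g ∘ₗ f = g' ∘ₗ f := by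
      refine LinearMap.pi_ext' fun i => LinearMap.ext_ring ?_
      simpa using congrFun hg i
    exact LinearMap.ext fun y => by obtain ⟨x, rfl⟩ := hf y; exact LinearMap.congr_fun this x
  | succ j ih =>
    obtain ⟨n, f, hf⟩ := Module.Finite.exists_fin' R N
    -- With `0 → K → R ^ n → N → 0`, the module `Ext^{j+1}(N, X)` is a quotient of `Ext^j(K, X)`,
    -- and `K` is finitely generated since `R` is Noetherian.
    have hT := LinearMap.shortExact_shortComplexKer hf
    have : Module.Finite R f.shortComplexKer.X₁ :=
      inferInstanceAs (Module.Finite R (LinearMap.ker f))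
    have : Projective f.shortComplexKer.X₂ :=
      (IsProjective.iff_projective (Fin n → R)).1 inferInstance
    have := Abelian.Ext.subsingleton_of_projective f.shortComplexKer.X₂ X j
    exact S.prop_ext_contravariant_X₃ hT X j (ih f.shortComplexKer.X₁) S.prop_of_subsingleton

end CategoryTheory.ObjectProperty

/-! ### `Φ`-torsion over a Noetherian ring -/

namespace IdealSystem

variable {R : Type u} [CommRing R] (Φ : IdealSystem R)

lemma exists_le_pow {a : Ideal R} (ha : a ∈ Φ) (k : ℕ) : ∃ b ∈ Φ, b ≤ a ^ k := by
  induction k with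
  | zero => exact ⟨a, ha, by simp⟩
  | succ k ih =>
    obtain ⟨b, hb, hle⟩ := ih
    obtain ⟨c, hc, hc'⟩ := Φ.exists_le_mul b hb a ha
    exact ⟨c, hc, hc'.trans (by rw [pow_succ]; exact Ideal.mul_mono_left hle)⟩

/-- The system of ideals formed by the powers of `a`. -/
def powers (a : Ideal R) : IdealSystem R where
  carrier := Set.range fun n : ℕ => a ^ n
  nonempty := Set.range_nonempty _
  exists_le_mul := by
    rintro _ ⟨m, rfl⟩ _ ⟨n, rfl⟩
    exact ⟨_, ⟨m + n, rfl⟩, (pow_add a m n).le⟩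

variable {M : Type u} [AddCommGroup M] [Module R M]

lemma mem_torsion_powers {a : Ideal R} {x : M} :
    x ∈ (powers a).torsion M ↔ ∃ n : ℕ, ∀ r ∈ a ^ n, r • x = 0 := by
  constructor
  · rintro ⟨_, ⟨n, rfl⟩, h⟩
    exact ⟨n, h⟩
  · rintro ⟨n, h⟩
    exact ⟨_, ⟨n, rfl⟩, h⟩

/-- A finitely generated torsion submodule is annihilated by a single member of the system. -/
lemma exists_mem_smul_eq_zero_of_fg (P : Submodule R M) (hP : P.FG) :
    P ≤ Φ.torsion M → ∃ b ∈ Φ, ∀ r ∈ b, ∀ x ∈ P, r • x = 0 := by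
  induction P, hP using Submodule.fg_induction with
  | singleton x =>
    intro h
    obtain ⟨b, hb, hx⟩ := h (Submodule.mem_span_singleton_self x)
    refine ⟨b, hb, fun r hr y hy => ?_⟩
    obtain ⟨s, rfl⟩ := Submodule.mem_span_singleton.1 hy
    rw [smul_comm, hx r hr, smul_zero]
  | sup P Q _ _ hP hQ =>
    intro h
    obtain ⟨b, hb, hx⟩ := hP (le_sup_left.trans h)
    obtain ⟨c, hc, hy⟩ := hQ (le_sup_right.trans h)
    obtain ⟨d, hd, hle⟩ := Φ.exists_le_mul b hb c hc
    refine ⟨d, hd, fun r hr z hz => ?_⟩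
    obtain ⟨x, hxP, y, hyQ, rfl⟩ := Submodule.mem_sup.1 hz
    rw [smul_add, hx r (Ideal.mul_le_left (hle hr)) x hxP,
      hy r (Ideal.mul_le_right (hle hr)) y hyQ, add_zero]

variable [IsNoetherianRing R]

/-- As `b x` is finitely generated, a single `c ∈ Φ` kills it; then `c * b` kills `x` and contains a
member of `Φ`. This is what makes `M ⧸ Γ_Φ(M)` torsion-free. -/
lemma mem_torsion_of_smul_mem {b : Ideal R} (hb : b ∈ Φ) {x : M}
    (h : ∀ r ∈ b, r • x ∈ Φ.torsion M) : x ∈ Φ.torsion M := by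
  obtain ⟨c, hc, hx⟩ := Φ.exists_mem_smul_eq_zero_of_fg
    (Submodule.map (LinearMap.toSpanSingleton R M x) b) ((IsNoetherian.noetherian b).map _) (by
      rintro _ ⟨r, hr, rfl⟩
      exact h r hr)
  obtain ⟨d, hd, hle⟩ := Φ.exists_le_mul c hc b hb
  refine ⟨d, hd, fun r hr => ?_⟩
  have : c * b ≤ LinearMap.ker (LinearMap.toSpanSingleton R M x) := by
    refine Ideal.mul_le.2 fun s hs r hr => ?_
    have := hx s hs _ ⟨r, hr, rfl⟩
    simpa [mul_smul] using this
  simpa using this (hle hr)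

/-- Over a Noetherian ring the torsion submodule of an injective module is injective. -/
instance injective_torsion [Module.Injective R M] : Module.Injective R (Φ.torsion M) := by
  refine Module.Baer.injective fun I f => ?_
  obtain ⟨b, hb, hbf⟩ := Φ.exists_mem_smul_eq_zero_of_fg
    (LinearMap.range ((Φ.torsion M).subtype ∘ₗ f))
    (by rw [LinearMap.range_eq_map]; exact (Module.Finite.fg_top).map _) (by
      rintro _ ⟨x, rfl⟩
      exact (f x).2)
  -- Artin-Rees: `b ^ (k + 1) ⊓ I ≤ b • I`, and `f` vanishes on `b • I` because `b` kills its range.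
  -- Hence `f` factors through the image of `I` in `R ⧸ b ^ (k + 1)`.
  obtain ⟨k, hk⟩ := b.exists_pow_inf_eq_pow_smul I
  have hker : LinearMap.ker ((b ^ (k + 1)).mkQ ∘ₗ I.subtype) ≤
      LinearMap.ker ((Φ.torsion M).subtype ∘ₗ f) := by
    rintro ⟨x, hxI⟩ hx
    have hx : x ∈ b ^ (k + 1) := (Submodule.Quotient.mk_eq_zero _).1 hx
    have hx : x ∈ b • I := by
      have h₁ : x ∈ b ^ (k + 1) • (⊤ : Ideal R) ⊓ I := ⟨by simpa using hx, hxI⟩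
      rw [hk (k + 1) (by omega), Nat.add_sub_cancel_left, pow_one] at h₁
      exact Submodule.smul_mono le_rfl inf_le_right h₁
    have key : b • I ≤ (LinearMap.ker ((Φ.torsion M).subtype ∘ₗ f)).map I.subtype := by
      refine Submodule.smul_le.2 fun r hr z hz => ⟨r • ⟨z, hz⟩, ?_, rfl⟩
      exact (map_smul _ r _).trans (hbf r hr _ ⟨⟨z, hz⟩, rfl⟩)
    obtain ⟨y, hy, rfl⟩ := key hx
    exact hy
  obtain ⟨h, hh⟩ := Module.Injective.out
    ((LinearMap.ker ((b ^ (k + 1)).mkQ ∘ₗ I.subtype)).liftQ ((b ^ (k + 1)).mkQ ∘ₗ I.subtype) le_rfl)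
    (LinearMap.ker_eq_bot.1 (Submodule.ker_liftQ_eq_bot _ _ _ le_rfl))
    ((LinearMap.ker ((b ^ (k + 1)).mkQ ∘ₗ I.subtype)).liftQ ((Φ.torsion M).subtype ∘ₗ f) hker)
  -- The extension `h` to `R ⧸ b ^ (k + 1)` has values in `M`, but its value at `1` is killed by `b
  -- ^ (k + 1)`, hence torsion; multiplying this element extends `f`.
  have he : h (Submodule.Quotient.mk 1) ∈ Φ.torsion M := by
    obtain ⟨c, hc, hle⟩ := Φ.exists_le_pow hb (k + 1)
    refine ⟨c, hc, fun r hr => ?_⟩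
    rw [← map_smul, ← Submodule.Quotient.mk_smul, smul_eq_mul, mul_one,
      (Submodule.Quotient.mk_eq_zero _).2 (hle hr), map_zero]
  refine ⟨LinearMap.toSpanSingleton R _ ⟨_, he⟩, fun x hx => Subtype.ext ?_⟩
  have := hh (Submodule.Quotient.mk ⟨x, hx⟩)
  simp only [Submodule.liftQ_apply] at this
  change _ = ((f ⟨x, hx⟩ : Φ.torsion M) : M) at this
  rw [← this]
  change x • h (Submodule.Quotient.mk 1) = h (Submodule.Quotient.mk x)
  rw [← map_smul, ← Submodule.Quotient.mk_smul, smul_eq_mul, mul_one]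

instance injective_torsionFunctor_obj (E : ModuleCat.{u} R) [Injective E] :
    Injective (Φ.torsionFunctor.obj E) := by
  have : Module.Injective R E := (Module.injective_iff_injective_object R E).2 inferInstance
  exact (Module.injective_iff_injective_object R (Φ.torsion E)).1 inferInstance

end IdealSystem

/-! ### Dimension shifting along four-term exact sequences -/

namespace CategoryTheory.ObjectProperty

variable {R : Type u} [CommRing R] (S : ObjectProperty (ModuleCat.{u} R)) [S.IsSerreClass]

section FourTerm

variable {Z J Z' H : ModuleCat.{u} R} {z : Z ⟶ J} {p : J ⟶ Z'} {π : Z' ⟶ H}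

/-- With the next lemma, this cuts `0 → Z → J → Z' → H → 0` at the image of `J → Z'`. -/
lemma shortExact_rangeRestrict (zp : z ≫ p = 0) (hz : Mono z) (h : (ShortComplex.mk z p zp).Exact) :
    (ShortComplex.mk z (ModuleCat.ofHom p.hom.rangeRestrict) (by
      ext x
      exact ConcreteCategory.congr_hom zp x)).ShortExact where
  exact := by
    rw [ShortComplex.moduleCat_exact_iff] at h ⊢
    exact fun x hx => h x congr(($hx).1)
  mono_f := hz
  epi_g := (ModuleCat.epi_iff_surjective _).2 p.hom.surjective_rangeRestrict

lemma shortExact_range_subtype (pπ : p ≫ π = 0) (hπ : Epi π)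
    (h : (ShortComplex.mk p π pπ).Exact) :
    (ShortComplex.mk (ModuleCat.ofHom (LinearMap.range p.hom).subtype) π (by
      ext ⟨_, x, rfl⟩
      exact ConcreteCategory.congr_hom pπ x)).ShortExact where
  exact := by
    rw [ShortComplex.moduleCat_exact_iff] at h ⊢
    intro x hx
    obtain ⟨y, hy⟩ := h x hx
    exact ⟨⟨x, y, hy⟩, rfl⟩
  mono_f := (ModuleCat.mono_iff_injective _).2 (Submodule.subtype_injective _)
  epi_g := hπ

variable (zp : z ≫ p = 0) (pπ : p ≫ π = 0) (hz : Mono z) (hπ : Epi π)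
  (h₁ : (ShortComplex.mk z p zp).Exact) (h₂ : (ShortComplex.mk p π pπ).Exact)
  (N : ModuleCat.{u} R)

include zp pπ hz hπ h₁ h₂

/-- For an exact sequence `0 → Z → J → Z' → H → 0` with `J` injective, the positive `Ext`s into
`Z'` are controlled by those into `Z` and `H`. -/
lemma prop_ext_of_fourTerm [Injective J] (j : ℕ)
    (hZ : S (ModuleCat.of R (Abelian.Ext N Z (j + 2))))
    (hH : S (ModuleCat.of R (Abelian.Ext N H (j + 1)))) :
    S (ModuleCat.of R (Abelian.Ext N Z' (j + 1))) := by
  have e₁ := shortExact_rangeRestrict zp hz h₁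
  have e₂ := shortExact_range_subtype pπ hπ h₂
  exact S.prop_ext_X₂ e₂ N (j + 1) (S.prop_ext_X₃_of_injective e₁ N j hZ) hH

/-- Comparison of an exact sequence `0 → Z → J → Z' → H → 0` with a short exact sequence
`0 → W → I → W' → 0`, `I` injective, such that every map `N → W'` factors through `Z'`. -/
lemma prop_ext_one_of_comparison {T : ShortComplex (ModuleCat.{u} R)} (hT : T.ShortExact)
    [Injective T.X₂] (c₁ : Z ⟶ T.X₁) (c₂ : J ⟶ T.X₂) (c₃ : Z' ⟶ T.X₃)
    (comm₁ : z ≫ c₂ = c₁ ≫ T.f) (comm₂ : p ≫ c₃ = c₂ ≫ T.g)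
    (hlift : ∀ f : N ⟶ T.X₃, ∃ g : N ⟶ Z', g ≫ c₃ = f)
    (hZ : S (ModuleCat.of R (Abelian.Ext N Z 1)))
    (hH : S (ModuleCat.of R (Abelian.Ext N H 0))) :
    S (ModuleCat.of R (Abelian.Ext N T.X₁ 1)) := by
  have e₁ := shortExact_rangeRestrict zp hz h₁
  have e₂ := shortExact_range_subtype pπ hπ h₂
  -- `Hom(N, Z')` surjects onto `Ext^1(N, W)` through `Hom(N, W')`, by `hlift` and injectivity of
  -- the middle term. A map to `Z'` that dies in `H` factors through the image of `J`; by naturality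
  -- of the connecting map, its class then comes from `Ext^1(N, Z)`.
  refine S.prop_of_surjective_of_ker_le
    ((Abelian.Ext.mk₀ c₁).postcompOfLinear R N (add_zero 1))
    ((hT.extClass.postcompOfLinear R N (zero_add 1)) ∘ₗ
      ((Abelian.Ext.mk₀ c₃).postcompOfLinear R N (add_zero 0)))
    ((Abelian.Ext.mk₀ π).postcompOfLinear R N (add_zero 0)) ?_ ?_ hZ hH
  · intro x
    obtain ⟨y, rfl⟩ := Abelian.Ext.covariant_sequence_exact₁ N hT x
      (Abelian.Ext.eq_zero_of_injective _) (zero_add 1)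
    obtain ⟨f, rfl⟩ := Abelian.Ext.homEquiv₀.symm.surjective y
    obtain ⟨g, rfl⟩ := hlift f
    exact ⟨Abelian.Ext.mk₀ g, by simp⟩
  · intro d hd
    obtain ⟨d', rfl⟩ := Abelian.Ext.covariant_sequence_exact₂ N e₂ d hd
    refine ⟨d'.comp e₁.extClass (zero_add 1), ?_⟩
    have := e₁.extClass_naturality hT
      { τ₁ := c₁
        τ₂ := c₂
        τ₃ := ModuleCat.ofHom (LinearMap.range p.hom).subtype ≫ c₃
        comm₁₂ := comm₁.symm
        comm₂₃ := by ext x; exact ConcreteCategory.congr_hom comm₂.symm x }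
    change (d'.comp e₁.extClass (zero_add 1)).comp (Abelian.Ext.mk₀ c₁) (add_zero 1) =
      ((d'.comp (Abelian.Ext.mk₀ (ModuleCat.ofHom (LinearMap.range p.hom).subtype))
        (add_zero 0)).comp (Abelian.Ext.mk₀ c₃) (add_zero 0)).comp hT.extClass (zero_add 1)
    rw [Abelian.Ext.comp_assoc_of_third_deg_zero, Abelian.Ext.comp_assoc_of_third_deg_zero,
      Abelian.Ext.mk₀_comp_mk₀, Abelian.Ext.comp_assoc_of_second_deg_zero]
    exact congrArg (fun y => d'.comp y (zero_add 1)) this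

end FourTerm

end CategoryTheory.ObjectProperty

/-! ### Exact sequences of cycles in a cochain complex -/

namespace CochainComplex

variable {C : Type*} [Category* C] [Abelian C] (K : CochainComplex C ℕ) (i : ℕ)

lemma iCycles_comp_toCycles : K.iCycles i ≫ K.toCycles i (i + 1) = 0 := by
  simp [← cancel_mono (K.iCycles (i + 1))]

/-- Since `Z^{i+1} → K^{i+1}` is mono, `K^i → Z^{i+1}` has the same kernel as the differential. -/
lemma exact_iCycles_toCycles :
    (ShortComplex.mk _ _ (K.iCycles_comp_toCycles i)).Exact := by
  have h := ShortComplex.exact_of_f_is_kernel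
    (ShortComplex.mk (K.iCycles i) (K.d i (i + 1)) (by simp)) (K.cyclesIsKernel i (i + 1) (by simp))
  let φ : ShortComplex.mk _ _ (K.iCycles_comp_toCycles i) ⟶
      ShortComplex.mk (K.iCycles i) (K.d i (i + 1)) (by simp) :=
    { τ₁ := 𝟙 _
      τ₂ := 𝟙 _
      τ₃ := K.iCycles (i + 1) }
  have : Epi φ.τ₁ := inferInstanceAs (Epi (𝟙 _))
  have : IsIso φ.τ₂ := inferInstanceAs (IsIso (𝟙 _))
  have : Mono φ.τ₃ := inferInstanceAs (Mono (K.iCycles (i + 1)))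
  exact (ShortComplex.exact_iff_of_epi_of_isIso_of_mono φ).2 h

lemma exact_toCycles_homologyπ :
    (ShortComplex.mk (K.toCycles i (i + 1)) (K.homologyπ (i + 1)) (by simp)).Exact :=
  ShortComplex.exact_of_g_is_cokernel _ (K.homologyIsCokernel i (i + 1) (by simp))

lemma shortExact_cycles (h : K.ExactAt (i + 1)) :
    (ShortComplex.mk _ _ (K.iCycles_comp_toCycles i)).ShortExact where
  exact := K.exact_iCycles_toCycles i
  mono_f := by dsimp; infer_instance
  epi_g := (K.exact_toCycles_homologyπ i).epi_f
    ((K.exactAt_iff_isZero_homology (i + 1)).1 h |>.eq_of_tgt _ _)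

end CochainComplex

/-! ### The torsion subcomplex -/

namespace IdealSystem

variable {R : Type u} [CommRing R] (Φ : IdealSystem R)

/-- The inclusion of `Γ_Φ K` into `K`, for a cochain complex `K`. -/
def torsionComplexι (K : CochainComplex (ModuleCat.{u} R) ℕ) :
    (Φ.torsionFunctor.mapHomologicalComplex _).obj K ⟶ K where
  f n := ModuleCat.ofHom (Φ.torsion (K.X n)).subtype
  comm' _ _ _ := rfl

/-- The image of `N` is killed by `b ∈ Φ`, so it is torsion; it stays in the cycles because the
torsion subcomplex is embedded in `K`. Only here does the annihilation of `N` by a member of `Φ`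
enter. -/
lemma exists_comp_cyclesMap_torsionComplexι (K : CochainComplex (ModuleCat.{u} R) ℕ)
    {N : ModuleCat.{u} R} {b : Ideal R} (hb : b ∈ Φ) (hN : ∀ r ∈ b, ∀ n : N, r • n = 0) (i : ℕ)
    (f : N ⟶ K.cycles i) :
    ∃ g, g ≫ HomologicalComplex.cyclesMap (Φ.torsionComplexι K) i = f := by
  let g₀ : N ⟶ ((Φ.torsionFunctor.mapHomologicalComplex _).obj K).X i :=
    ModuleCat.ofHom (LinearMap.codRestrict (Φ.torsion (K.X i)) (f ≫ K.iCycles i).hom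
      fun n => ⟨b, hb, fun r hr => by rw [← map_smul, hN r hr, map_zero]⟩)
  have h₀ : g₀ ≫ (Φ.torsionComplexι K).f i = f ≫ K.iCycles i := rfl
  have hmono : Mono ((Φ.torsionComplexι K).f (i + 1)) :=
    (ModuleCat.mono_iff_injective _).2 (Submodule.subtype_injective _)
  refine ⟨HomologicalComplex.liftCycles _ g₀ (i + 1) (by simp) ?_, ?_⟩
  · rw [← cancel_mono ((Φ.torsionComplexι K).f (i + 1)), Category.assoc,
      ← HomologicalComplex.Hom.comm, reassoc_of% h₀]
    simp
  · rw [← cancel_mono (K.iCycles i), Category.assoc, HomologicalComplex.cyclesMap_i]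
    simpa using h₀

end IdealSystem

/-- The zeroth cycles of an injective resolution of `M` are `M`. -/
noncomputable def CategoryTheory.InjectiveResolution.isoCycles {C : Type*} [Category* C] [Abelian C]
    {M : C} (I : InjectiveResolution M) : M ≅ I.cocomplex.cycles 0 :=
  Limits.IsLimit.conePointUniqueUpToIso I.isLimitKernelFork
    (I.cocomplex.cyclesIsKernel 0 1 (by simp))

/-! ### From `Ext(N, H_Φ(M))` to `Ext(N, M)` -/

namespace CategoryTheory.ObjectProperty

variable {R : Type u} [CommRing R] (S : ObjectProperty (ModuleCat.{u} R)) [S.IsSerreClass]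

/-- Dimension shifting along an injective resolution. -/
lemma prop_ext_cycles {M : ModuleCat.{u} R} (I : InjectiveResolution M) (N : ModuleCat.{u} R)
    (j i : ℕ) (h : S (ModuleCat.of R (Abelian.Ext N (I.cocomplex.cycles (i + j)) 1))) :
    S (ModuleCat.of R (Abelian.Ext N (I.cocomplex.cycles i) (j + 1))) := by
  induction j generalizing i with
  | zero => exact h
  | succ j ih =>
    have hT := CochainComplex.shortExact_cycles I.cocomplex i (I.cocomplex_exactAt_succ i)
    have : Injective (I.cocomplex.X i) := I.injective i
    refine S.prop_ext_X₁_of_injective hT N (j + 1) (ih (i + 1) ?_)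
    rwa [add_right_comm, add_assoc]

variable [IsNoetherianRing R]

/-- If the modules `Ext^j(N, H^i_Φ(M))` with `i + j < t` lie in a Serre class and `N` is
annihilated by a member of `Φ`, then the modules `Ext^i(N, M)` with `i < t` lie in that class. -/
theorem prop_ext_of_prop_ext_localCohomology (Φ : IdealSystem R) (M N : ModuleCat.{u} R)
    {b : Ideal R} (hb : b ∈ Φ) (hN : ∀ r ∈ b, ∀ n : N, r • n = 0) (t : ℕ)
    (h : ∀ i < t, ∀ j < t - i,
      S (ModuleCat.of R (Abelian.Ext N ((Φ.localCohomology i).obj M) j))) (i : ℕ) (hi : i < t) :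
    S (ModuleCat.of R (Abelian.Ext N M i)) := by
  let I := injectiveResolution M
  let J := (Φ.torsionFunctor.mapHomologicalComplex (ComplexShape.up ℕ)).obj I.cocomplex
  have hJ (i : ℕ) : Injective (J.X i) :=
    have : Injective (I.cocomplex.X i) := I.injective i
    Φ.injective_torsionFunctor_obj _
  have hH (i j : ℕ) (hij : i + j < t) : S (ModuleCat.of R (Abelian.Ext N (J.homology i) j)) :=
    S.prop_ext_of_iso (I.isoRightDerivedObj Φ.torsionFunctor i) N j
      (h i (by omega) j (by omega))
  have hZ₀ (j : ℕ) (hj : j < t) : S (ModuleCat.of R (Abelian.Ext N (J.cycles 0) j)) :=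
    S.prop_ext_of_iso (CochainComplex.isoHomologyπ₀ J).symm N j (hH 0 j (by omega))
  -- The four-term sequence bounds `Ext^{j+1}(N, Z^{i+1})` by `Ext^{j+2}(N, Z^i)` and `Ext^{j+1}(N,
  -- H^{i+1})`. All three have the same total degree, so the bound by `t` is preserved.
  have hZ (i : ℕ) : ∀ j, i + (j + 1) < t →
      S (ModuleCat.of R (Abelian.Ext N (J.cycles i) (j + 1))) := by
    induction i with
    | zero => exact fun j hj => hZ₀ (j + 1) (by omega)
    | succ i ih =>
      exact fun j hj => S.prop_ext_of_fourTerm _ _ inferInstance inferInstance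
        (CochainComplex.exact_iCycles_toCycles J i) (CochainComplex.exact_toCycles_homologyπ J i) N j
        (ih (j + 1) (by omega)) (hH (i + 1) (j + 1) (by omega))
  -- The cycles of `I` are compared with those of `J`; both inputs, `Ext^1(N, Z^i)` and `Hom(N,
  -- H^{i+1})`, have total degree `i + 1`.
  have hW (i : ℕ) (hi : i + 1 < t) :
      S (ModuleCat.of R (Abelian.Ext N (I.cocomplex.cycles i) 1)) := by
    have hT := CochainComplex.shortExact_cycles I.cocomplex i (I.cocomplex_exactAt_succ i)
    have : Injective (I.cocomplex.X i) := I.injective i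
    exact S.prop_ext_one_of_comparison _ _ inferInstance inferInstance
        (CochainComplex.exact_iCycles_toCycles J i) (CochainComplex.exact_toCycles_homologyπ J i) N
        hT (HomologicalComplex.cyclesMap (Φ.torsionComplexι I.cocomplex) i)
        ((Φ.torsionComplexι I.cocomplex).f i)
        (HomologicalComplex.cyclesMap (Φ.torsionComplexι I.cocomplex) (i + 1))
        (by simp [J]) (by simp [J, ← cancel_mono (I.cocomplex.iCycles (i + 1))])
        (Φ.exists_comp_cyclesMap_torsionComplexι I.cocomplex hb hN (i + 1))
        (hZ i 0 (by omega)) (hH (i + 1) 0 (by omega))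
  refine S.prop_ext_of_iso I.isoCycles.symm N i ?_
  cases i with
  | zero =>
    refine S.prop_of_surjective ((Abelian.Ext.mk₀
      (HomologicalComplex.cyclesMap (Φ.torsionComplexι I.cocomplex) 0)).postcompOfLinear R N
        (add_zero 0)) ?_ (hZ₀ 0 hi)
    intro x
    obtain ⟨f, rfl⟩ := Abelian.Ext.homEquiv₀.symm.surjective x
    obtain ⟨g, rfl⟩ := Φ.exists_comp_cyclesMap_torsionComplexι I.cocomplex hb hN 0 f
    exact ⟨Abelian.Ext.mk₀ g, by simp⟩
  | succ i => exact S.prop_ext_cycles I N i 0 (hW (0 + i) (by omega))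

end CategoryTheory.ObjectProperty

/-! ### Changing the first argument of `Ext` within its support -/

lemma Submodule.shortExact_mkQ {R : Type*} [Ring R] {M : Type u} [AddCommGroup M] [Module R M]
    (P : Submodule R M) :
    (ShortComplex.mk (ModuleCat.ofHom P.subtype) (ModuleCat.ofHom P.mkQ)
      (by ext; simp)).ShortExact where
  exact := (ShortComplex.ShortExact.moduleCat_exact_iff_function_exact _).2
    (LinearMap.exact_subtype_mkQ _)
  mono_f := (ModuleCat.mono_iff_injective _).2 P.subtype_injective
  epi_g := (ModuleCat.epi_iff_surjective _).2 P.mkQ_surjective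

namespace CategoryTheory.ObjectProperty

variable {R : Type u} [CommRing R] [IsNoetherianRing R] (S : ObjectProperty (ModuleCat.{u} R))
  [S.IsSerreClass]

/-- `Ext^i(-, M)` lands in a Serre class on all finitely generated modules supported in `C` as soon
as it does so on the modules `R ⧸ p` with `p ∈ C`. -/
lemma prop_ext_of_quotient_prime (M : ModuleCat.{u} R) (i : ℕ) (C : Set (PrimeSpectrum R))
    (h : ∀ p ∈ C, S (ModuleCat.of R (Abelian.Ext (ModuleCat.of R (R ⧸ p.asIdeal)) M i)))
    (N : Type u) [AddCommGroup N] [Module R N] [hN : Module.Finite R N]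
    (hC : Module.support R N ⊆ C) :
    S (ModuleCat.of R (Abelian.Ext (ModuleCat.of R N) M i)) := by
  induction hN using IsNoetherianRing.induction_on_isQuotientEquivQuotientPrime R with
  | subsingleton N =>
    have : Subsingleton (Abelian.Ext (ModuleCat.of R N) M i) := by
      refine subsingleton_of_forall_eq 0 fun x => ?_
      rw [← Abelian.Ext.mk₀_id_comp x,
        (ModuleCat.isZero_of_subsingleton (ModuleCat.of R N)).eq_of_src (𝟙 _) 0]
      simp
    exact S.prop_of_subsingleton
  | quotient N p e =>
    refine S.prop_ext_contravariant_of_iso e.toModuleIso M i (h p (hC ?_))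
    rw [e.support_eq, Module.mem_support_iff_of_finite, Ideal.annihilator_quotient]
  | exact N₁ N₂ N₃ f g hf hg hfg h₁ h₃ =>
    have hsupp := Module.support_of_exact hfg hf hg
    rw [hsupp, Set.union_subset_iff] at hC
    let T := ShortComplex.mk (ModuleCat.ofHom f) (ModuleCat.ofHom g) (by
      ext x
      exact hfg.apply_apply_eq_zero x)
    have hT : T.ShortExact :=
      { exact := (ShortComplex.ShortExact.moduleCat_exact_iff_function_exact _).2 hfg
        mono_f := (ModuleCat.mono_iff_injective _).2 hf
        epi_g := (ModuleCat.epi_iff_surjective _).2 hg }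
    exact S.prop_ext_contravariant_X₂ hT M i (h₁ hC.1) (h₃ hC.2)

/-- If `Hom(N, R ⧸ p) = 0`, then `ann N` contains an `R ⧸ p`-regular element; but `ann N ≤ p`, so
that element acts as zero on `R ⧸ p ≠ 0`. -/
lemma exists_linearMap_quotient_ne_zero (N : Type u) [AddCommGroup N] [Module R N]
    [Module.Finite R N] (p : PrimeSpectrum R) (hp : p ∈ Module.support R N) :
    ∃ f : N →ₗ[R] R ⧸ p.asIdeal, f ≠ 0 := by
  by_contra! h
  have : Subsingleton (N →ₗ[R] R ⧸ p.asIdeal) := subsingleton_of_forall_eq 0 h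
  obtain ⟨r, hr, hreg⟩ := IsSMulRegular.subsingleton_linearMap_iff.1 this
  have hrp : r ∈ p.asIdeal := Module.annihilator_le_of_mem_support hp hr
  have h₁ : (1 : R ⧸ p.asIdeal) = 0 := hreg (by
    dsimp only
    rw [smul_zero, Algebra.smul_def, mul_one]
    exact Ideal.Quotient.eq_zero_iff_mem.2 hrp)
  exact one_ne_zero h₁

/-- If `Ext^i(N, M)` lies in a Serre class for all `i < t`, then so does `Ext^i(N', M)` for every
finitely generated `N'` with `Supp N' ⊆ Supp N`. -/
theorem prop_ext_of_support_subset (M N : ModuleCat.{u} R) [Module.Finite R N] (t : ℕ)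
    (h : ∀ i < t, S (ModuleCat.of R (Abelian.Ext N M i))) (i : ℕ) (hi : i < t)
    (N' : Type u) [AddCommGroup N'] [Module R N'] [Module.Finite R N']
    (hN' : Module.support R N' ⊆ Module.support R N) :
    S (ModuleCat.of R (Abelian.Ext (ModuleCat.of R N') M i)) := by
  induction i using Nat.strong_induction_on generalizing N' with
  | _ i ih =>
  refine S.prop_ext_of_quotient_prime M i (Module.support R N) ?_ N' hN'
  rintro ⟨p, hp⟩ hpN
  -- Noetherian induction: the claim is assumed for primes strictly above `p`. A nonzero `f : N → R
  -- ⧸ p` then splits `R ⧸ p` into `range f`, a quotient of `N`, and a cokernel supported strictly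
  -- above `p`.
  induction p using (wellFounded_gt (α := Ideal R)).induction with
  | _ p ihp =>
  obtain ⟨f, hf⟩ := exists_linearMap_quotient_ne_zero N ⟨p, hp⟩ hpN
  have hrange : S (ModuleCat.of R (Abelian.Ext (ModuleCat.of R (LinearMap.range f)) M i)) := by
    cases i with
    | zero =>
      have : Epi (ModuleCat.ofHom f.rangeRestrict) :=
        (ModuleCat.epi_iff_surjective _).2 f.surjective_rangeRestrict
      exact S.prop_ext_contravariant_X₃_zero M (ModuleCat.ofHom f.rangeRestrict) (h 0 hi)
    | succ i =>
      -- `Ext^{i+1}(range f, M)` lies between `Ext^i(ker f, M)`, known from the lower degree, and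
      -- `Ext^{i+1}(N, M)`.
      refine S.prop_ext_contravariant_X₃
        (LinearMap.shortExact_shortComplexKer f.surjective_rangeRestrict) M i ?_ (h _ hi)
      exact ih i (by omega) (by omega) (LinearMap.ker f.rangeRestrict)
        (Module.support_subset_of_injective _ (Submodule.subtype_injective _))
  have hquot : S (ModuleCat.of R
      (Abelian.Ext (ModuleCat.of R ((R ⧸ p) ⧸ LinearMap.range f)) M i)) := by
    refine S.prop_ext_of_quotient_prime M i
      (Module.support R ((R ⧸ p) ⧸ LinearMap.range f)) ?_ _ le_rfl
    rintro ⟨q, hq⟩ hqs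
    have hann := Module.annihilator_le_of_mem_support hqs
    have hpq : p ≤ q := le_trans (fun r hr => Module.mem_annihilator.2 fun x => by
      obtain ⟨x, rfl⟩ := Submodule.mkQ_surjective _ x
      obtain ⟨x, rfl⟩ := Ideal.Quotient.mk_surjective x
      rw [← map_smul, Algebra.smul_def, Ideal.Quotient.algebraMap_eq,
        Ideal.Quotient.eq_zero_iff_mem.2 hr, zero_mul, map_zero]) hann
    have hlt : p < q := by
      refine lt_of_le_of_ne hpq ?_
      -- Any lift `s` of `f n` annihilates the cokernel, since `f n * x = f (x • n)`. If `p` were in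
      -- the support, then `s ∈ p` and `f n = 0` for every `n`.
      rintro rfl
      refine hf (LinearMap.ext fun n => ?_)
      obtain ⟨s, hs⟩ := Ideal.Quotient.mk_surjective (f n)
      rw [← hs, LinearMap.zero_apply, Ideal.Quotient.eq_zero_iff_mem]
      refine hann (Module.mem_annihilator.2 fun x => ?_)
      obtain ⟨x, rfl⟩ := Submodule.mkQ_surjective _ x
      obtain ⟨x, rfl⟩ := Ideal.Quotient.mk_surjective x
      rw [← map_smul, Submodule.mkQ_apply, Submodule.Quotient.mk_eq_zero]
      refine ⟨x • n, ?_⟩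
      rw [map_smul, ← hs, Algebra.smul_def, Algebra.smul_def, mul_comm]
      rfl
    exact ihp q hlt hq (Module.mem_support_mono (p := ⟨p, hp⟩) hpq hpN)
  exact S.prop_ext_contravariant_X₂ (LinearMap.range f).shortExact_mkQ M i hrange hquot

end CategoryTheory.ObjectProperty

/-! ### Comparison of the two constructions of `Ext` -/

namespace CategoryTheory.ProjectiveResolution

variable {R : Type u} [CommRing R] {N : ModuleCat.{u} R} (P : ProjectiveResolution N)
  (M : ModuleCat.{u} R) (n : ℕ)

/-- The complex `Hom(P, M)`, as a chain complex in the opposite category of modules. -/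
noncomputable abbrev homComplex : ChainComplex (ModuleCat.{u} R)ᵒᵖ ℕ :=
  (((linearYoneda R (ModuleCat.{u} R)).obj M).rightOp.mapHomologicalComplex _).obj P.complex

/-- The module of `n`-cocycles of `Hom(P, M)`. -/
noncomputable abbrev cocycles : ModuleCat.{u} R := ((P.homComplex M).opcycles n).unop

/-- The inclusion of the cocycles in `Hom(P_n, M)`. -/
noncomputable def cocyclesι : P.cocycles M n →ₗ[R] (P.complex.X n ⟶ M) :=
  ((P.homComplex M).pOpcycles n).unop.hom

/-- The defining derived functor of `Ext^n(-, M)` is computed by `Hom(P, M)`. -/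
noncomputable def isoHomologyHomComplex :
    (((linearYoneda R (ModuleCat.{u} R)).obj M).rightOp.leftDerived n).obj N ≅
      (P.homComplex M).homology n :=
  P.isoLeftDerivedObj ((linearYoneda R (ModuleCat.{u} R)).obj M).rightOp n

/-- The class of a cocycle in `Ext^n(N, M)`, the latter being defined by deriving `Hom(-, M)`. -/
noncomputable def cocyclesToExt :
    P.cocycles M n ⟶ ((Ext R (ModuleCat.{u} R) n).obj (Opposite.op N)).obj M :=
  ((P.isoHomologyHomComplex M n).hom ≫ (P.homComplex M).homologyι n).unop

lemma cocyclesToExt_surjective : Function.Surjective (P.cocyclesToExt M n) := by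
  rw [← ModuleCat.epi_iff_surjective]
  exact inferInstanceAs
    (Epi ((P.isoHomologyHomComplex M n).hom ≫ (P.homComplex M).homologyι n).unop)

lemma cocyclesι_injective : Function.Injective (P.cocyclesι M n) := by
  exact (ModuleCat.mono_iff_injective ((P.homComplex M).pOpcycles n).unop).1 inferInstance

lemma d_comp_cocyclesι (z : P.cocycles M n) :
    P.complex.d (n + 1) n ≫ P.cocyclesι M n z = 0 := by
  have h : (P.homComplex M).d (n + 1) n ≫ (P.homComplex M).pOpcycles n = 0 :=
    HomologicalComplex.d_pOpcycles _ _ _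
  exact ConcreteCategory.congr_hom congr(($h).unop) z

/-- Opcycles in the opposite category have the universal property of a kernel after `unop`. The
element `f` is encoded as a map from `R`, which that property lifts. -/
lemma exists_cocyclesι_eq (f : P.complex.X n ⟶ M) (hf : P.complex.d (n + 1) n ≫ f = 0) :
    ∃ z, P.cocyclesι M n z = f := by
  let k : (P.homComplex M).X n ⟶ Opposite.op (ModuleCat.of R R) :=
    Quiver.Hom.op (ModuleCat.ofHom (LinearMap.toSpanSingleton R (P.complex.X n ⟶ M) f))
  have hk : (P.homComplex M).d (n + 1) n ≫ k = 0 := by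
    apply Quiver.Hom.unop_inj
    refine ModuleCat.hom_ext (LinearMap.ext_ring ?_)
    change P.complex.d (n + 1) n ≫ ((1 : R) • f) = 0
    rw [one_smul, hf]
  have h := (P.homComplex M).p_descOpcycles k (n + 1) (by simp) hk
  refine ⟨((P.homComplex M).descOpcycles k (n + 1) (by simp) hk).unop (1 : R), ?_⟩
  refine (ConcreteCategory.congr_hom congr(($h).unop) (1 : R)).trans ?_
  exact one_smul R f

lemma cocyclesToExt_eq_zero (z : P.cocycles M (n + 1)) (g : P.complex.X n ⟶ M)
    (h : P.complex.d (n + 1) n ≫ g = P.cocyclesι M (n + 1) z) :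
    P.cocyclesToExt M (n + 1) z = 0 := by
  have hz : z = ((P.homComplex M).fromOpcycles (n + 1) n).unop g := by
    apply P.cocyclesι_injective
    rw [← h]
    exact (ConcreteCategory.congr_hom
      congr(($((P.homComplex M).p_fromOpcycles (n + 1) n)).unop) g).symm
  have h₀ : ((P.isoHomologyHomComplex M (n + 1)).hom ≫ (P.homComplex M).homologyι (n + 1)) ≫
      (P.homComplex M).fromOpcycles (n + 1) n = 0 := by simp
  rw [hz]
  exact ConcreteCategory.congr_hom congr(($h₀).unop) g

variable {P M n} in
-- There are no nonzero coboundaries in degree zero: the cochain complex of `P` vanishes in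
-- cohomological degree `1`, where a witness `g` would start.
lemma extMk_zero_eq_zero (f : P.complex.X 0 ⟶ M) (hf : P.complex.d 1 0 ≫ f = 0)
    (h : P.extMk f 1 rfl hf = 0) : f = 0 := by
  rw [← P.extEquivCohomologyClass.apply_eq_iff_eq, extEquivCohomologyClass_extMk,
    extEquivCohomologyClass_zero, CochainComplex.HomComplex.CohomologyClass.mk_eq_zero_iff,
    CochainComplex.HomComplex.Cocycle.toSingleMk_mem_coboundaries_iff _ _ _ _ _ 1 (by simp)] at h
  obtain ⟨g, hg⟩ := h
  rw [(P.cochainComplex.isZero_of_isStrictlyLE 0 1 (by simp)).eq_of_src g 0, Limits.comp_zero] at hg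
  rw [← cancel_epi (P.cochainComplexXIso (-(0 : ℕ)) 0 rfl).hom, ← hg, Limits.comp_zero]

/-- The class of a cocycle in `Abelian.Ext N M n`. -/
noncomputable def cocyclesToAbelianExt : P.cocycles M n →ₗ[R] Abelian.Ext N M n where
  toFun z := P.extMk (P.cocyclesι M n z) (n + 1) rfl (P.d_comp_cocyclesι M n z)
  map_add' z w := by
    rw [add_extMk]
    congr 1
    exact map_add _ _ _
  map_smul' r z := by
    rw [RingHom.id_apply, Abelian.Ext.smul_eq_comp_mk₀, extMk_comp_mk₀]
    congr 1
    rw [map_smul]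
    simp

lemma cocyclesToAbelianExt_surjective : Function.Surjective (P.cocyclesToAbelianExt M n) := by
  intro x
  obtain ⟨f, hf, rfl⟩ := P.extMk_surjective x (n + 1) rfl
  obtain ⟨z, rfl⟩ := P.exists_cocyclesι_eq M n f hf
  exact ⟨z, rfl⟩

/-- A cocycle with zero class is a coboundary. This one inclusion makes the comparison map well
defined; its injectivity is never needed. -/
lemma ker_cocyclesToAbelianExt_le :
    LinearMap.ker (P.cocyclesToAbelianExt M n) ≤ LinearMap.ker (P.cocyclesToExt M n).hom := by
  intro z hz
  cases n with
  | zero =>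
    have h := extMk_zero_eq_zero _ (P.d_comp_cocyclesι M 0 z) hz
    rw [P.cocyclesι_injective M 0 (h.trans (map_zero _).symm)]
    exact map_zero _
  | succ n =>
    obtain ⟨g, hg⟩ := (P.extMk_eq_zero_iff _ _ rfl
      (P.d_comp_cocyclesι M (n + 1) z) n rfl).1 hz
    exact P.cocyclesToExt_eq_zero M n z g hg

/-- The comparison of the two definitions of `Ext`. -/
noncomputable def extComparison :
    Abelian.Ext N M n →ₗ[R] ((Ext R (ModuleCat.{u} R) n).obj (Opposite.op N)).obj M :=
  (LinearMap.ker (P.cocyclesToAbelianExt M n)).liftQ (P.cocyclesToExt M n).hom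
      (P.ker_cocyclesToAbelianExt_le M n) ∘ₗ
    ((P.cocyclesToAbelianExt M n).quotKerEquivOfSurjective
      (P.cocyclesToAbelianExt_surjective M n)).symm.toLinearMap

lemma extComparison_apply (z : P.cocycles M n) :
    P.extComparison M n (P.cocyclesToAbelianExt M n z) = P.cocyclesToExt M n z := by
  have : ((P.cocyclesToAbelianExt M n).quotKerEquivOfSurjective
      (P.cocyclesToAbelianExt_surjective M n)).symm (P.cocyclesToAbelianExt M n z) =
        Submodule.Quotient.mk z := by
    rw [LinearEquiv.symm_apply_eq]
    rfl
  rw [extComparison, LinearMap.comp_apply, LinearEquiv.coe_coe, this]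
  rfl

lemma extComparison_surjective : Function.Surjective (P.extComparison M n) := by
  intro x
  obtain ⟨z, rfl⟩ := P.cocyclesToExt_surjective M n x
  exact ⟨_, P.extComparison_apply M n z⟩

/-- A lift `φ` of `f` to the resolutions computes both functorialities on cocycles. Naturality makes
the comparison compatible with the transition maps of the direct system. -/
lemma extComparison_naturality {N' : ModuleCat.{u} R} (P' : ProjectiveResolution N') (f : N' ⟶ N)
    (x : Abelian.Ext N M n) :
    P'.extComparison M n ((Abelian.Ext.mk₀ f).comp x (zero_add n)) =
      ((Ext R (ModuleCat.{u} R) n).map f.op).app M (P.extComparison M n x) := by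
  obtain ⟨z, rfl⟩ := P.cocyclesToAbelianExt_surjective M n x
  let F := ((linearYoneda R (ModuleCat.{u} R)).obj M).rightOp
  let φ := ProjectiveResolution.lift f P' P
  have hφ := ProjectiveResolution.lift_commutes_zero f P' P
  let φ' : Hom P' P f := ⟨φ, hφ⟩
  let ψ := HomologicalComplex.opcyclesMap ((F.mapHomologicalComplex _).map φ) n
  have h₁ : (Abelian.Ext.mk₀ f).comp (P.cocyclesToAbelianExt M n z) (zero_add n) =
      P'.cocyclesToAbelianExt M n (ψ.unop z) := by
    refine (mk₀_comp_extMk _ _ rfl (P.d_comp_cocyclesι M n z) φ').trans ?_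
    change P'.extMk _ _ _ _ = P'.extMk _ (n + 1) rfl (P'.d_comp_cocyclesι M n _)
    congr 1
    have := HomologicalComplex.p_opcyclesMap ((F.mapHomologicalComplex _).map φ) n
    exact (ConcreteCategory.congr_hom congr(($this).unop) z).symm
  rw [h₁, extComparison_apply, extComparison_apply]
  have h₂ : (F.leftDerived n).map f ≫ (P.isoHomologyHomComplex M n).hom =
      (P'.isoHomologyHomComplex M n).hom ≫
        HomologicalComplex.homologyMap ((F.mapHomologicalComplex _).map φ) n :=
    isoLeftDerivedObj_hom_naturality f P' P φ hφ F n
  have h₃ : (F.leftDerived n).map f ≫ (P.isoHomologyHomComplex M n).hom ≫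
      (P.homComplex M).homologyι n =
      ((P'.isoHomologyHomComplex M n).hom ≫ (P'.homComplex M).homologyι n) ≫ ψ := by
    rw [reassoc_of% h₂, Category.assoc, HomologicalComplex.homologyι_naturality]
  exact (ConcreteCategory.congr_hom congr(($h₃).unop) z).symm

end CategoryTheory.ProjectiveResolution

/-! ### Local cohomology and the direct limit of `Ext^i(R ⧸ a ^ n, M)` -/

section DirectLimit

open localCohomology

variable {R : Type u} [CommRing R] (a : Ideal R)

/-- The inverse system of the modules `R ⧸ a ^ n`. -/
noncomputable abbrev Ideal.powerQuotients : ℕᵒᵖ ⥤ ModuleCat.{u} R :=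
  ringModIdeals (idealPowersDiagram a)

variable (i : ℕ) (M : ModuleCat.{u} R)

/-- The transition maps `Ext^i(R ⧸ a ^ m, M) → Ext^i(R ⧸ a ^ n, M)` for `m ≤ n`. -/
noncomputable def Ideal.extTransition (m n : ℕ) (h : m ≤ n) :
    Abelian.Ext (a.powerQuotients.obj (.op m)) M i →ₗ[R]
      Abelian.Ext (a.powerQuotients.obj (.op n)) M i :=
  (Abelian.Ext.mk₀ (a.powerQuotients.map (homOfLE h).op)).precompOfLinear R M (zero_add i)

instance : DirectedSystem (fun n => Abelian.Ext (a.powerQuotients.obj (.op n)) M i)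
    (fun m n h => a.extTransition i M m n h) where
  map_self n x := by
    change (Abelian.Ext.mk₀ (a.powerQuotients.map (𝟙 _))).comp x (zero_add i) = x
    rw [CategoryTheory.Functor.map_id, Abelian.Ext.mk₀_id_comp]
  map_map k m n hkm hmn x := by
    change (Abelian.Ext.mk₀ (a.powerQuotients.map (homOfLE hmn).op)).comp
      ((Abelian.Ext.mk₀ (a.powerQuotients.map (homOfLE hkm).op)).comp x (zero_add i))
        (zero_add i) =
      (Abelian.Ext.mk₀ (a.powerQuotients.map (homOfLE (hkm.trans hmn)).op)).comp x (zero_add i)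
    rw [Abelian.Ext.mk₀_comp_mk₀_assoc, ← Functor.map_comp]
    rfl

/-- The direct limit of the modules `Ext^i(R ⧸ a ^ n, M)`. -/
abbrev Ideal.ExtLimit : Type u :=
  Module.DirectLimit (fun n => Abelian.Ext (a.powerQuotients.obj (.op n)) M i)
    (a.extTransition i M)

/-- The local cohomology module is a quotient of the direct limit of the modules
`Abelian.Ext (R ⧸ a ^ n) M i`. -/
lemma Ideal.exists_extLimit_surjective :
    ∃ f : a.ExtLimit i M →ₗ[R] (localCohomology a i).obj M, Function.Surjective f := by
  let D := diagram (idealPowersDiagram a) i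
  have hD : Limits.HasColimit D := hasColimitDiagram.{u, 0} (idealPowersDiagram a) i
  let c := ((evaluation _ _).obj M).mapCocone (Limits.colimit.cocone D)
  have hc : Limits.IsColimit c :=
    Limits.isColimitOfPreserves _ (Limits.colimit.isColimit D)
  let e (n : ℕ) := (projectiveResolution (a.powerQuotients.obj (.op n))).extComparison M i
  let ι (n : ℕ) : Abelian.Ext (a.powerQuotients.obj (.op n)) M i →ₗ[R]
      (localCohomology a i).obj M := (c.ι.app (.op (.op n))).hom ∘ₗ e n
  have hι (m n : ℕ) (h : m ≤ n) (x) : ι n (a.extTransition i M m n h x) = ι m x := by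
    have h₁ : e n (a.extTransition i M m n h x) =
        (D.map (homOfLE h).op.op).app M (e m x) :=
      ProjectiveResolution.extComparison_naturality (projectiveResolution _) M i
        (projectiveResolution _) _ x
    have h₂ := c.w (homOfLE h).op.op
    change (c.ι.app (.op (.op n))) (e n (a.extTransition i M m n h x)) = _
    rw [h₁]
    exact ConcreteCategory.congr_hom h₂ (e m x)
  let f : a.ExtLimit i M →ₗ[R] (localCohomology a i).obj M := Module.DirectLimit.lift R ℕ _ _ ι hι
  refine ⟨f, LinearMap.range_eq_top.1 ?_⟩
  -- Each leg of the colimit cocone has its image in `range f`, by surjectivity of the comparison;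
  -- so the projection modulo `range f` vanishes on every leg.
  have hf : ModuleCat.ofHom (LinearMap.range f).mkQ = (0 : c.pt ⟶ _) := by
    refine hc.hom_ext ?_
    rintro ⟨⟨n⟩⟩
    ext z
    obtain ⟨x, rfl⟩ := ProjectiveResolution.extComparison_surjective
      (projectiveResolution (a.powerQuotients.obj (.op n))) M i z
    refine (Submodule.Quotient.mk_eq_zero _).2 ⟨Module.DirectLimit.of R ℕ _ _ n x, ?_⟩
    exact Module.DirectLimit.lift_of _ _ _
  rw [← Submodule.ker_mkQ (LinearMap.range f), LinearMap.ker_eq_top]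
  exact congr(($hf).hom)

end DirectLimit

/-! ### Torsion and torsion-free injective modules -/

namespace IdealSystem

variable {R : Type u} [CommRing R] [IsNoetherianRing R] (Φ : IdealSystem R)
  {M : Type u} [AddCommGroup M] [Module R M]

lemma torsion_quotient_torsion (x : M ⧸ Φ.torsion M) (hx : x ∈ Φ.torsion (M ⧸ Φ.torsion M)) :
    x = 0 := by
  obtain ⟨x, rfl⟩ := Submodule.mkQ_surjective _ x
  obtain ⟨b, hb, h⟩ := hx
  refine (Submodule.Quotient.mk_eq_zero _).2 (Φ.mem_torsion_of_smul_mem hb fun r hr => ?_)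
  exact (Submodule.Quotient.mk_eq_zero _).1 (h r hr)

/-- The torsion-free quotient of an injective module is injective. -/
lemma injective_quotient_torsion [Module.Injective R M] :
    Module.Injective R (M ⧸ Φ.torsion M) := by
  obtain ⟨ρ, hρ⟩ := Module.Injective.out (Φ.torsion M).subtype
    (Submodule.subtype_injective _) LinearMap.id
  -- Since `Γ_Φ(M)` is injective, its inclusion has a retraction `ρ`; `id - ρ` descends to a section
  -- of the projection, and the quotient is a retract of `M`.
  let s : M ⧸ Φ.torsion M →ₗ[R] M :=
    (Φ.torsion M).liftQ (LinearMap.id - (Φ.torsion M).subtype ∘ₗ ρ) fun x hx => by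
      have h : ρ x = ⟨x, hx⟩ := hρ ⟨x, hx⟩
      simp [h]
  have hs (x) : (Φ.torsion M).mkQ (s x) = x := by
    obtain ⟨x, rfl⟩ := Submodule.mkQ_surjective _ x
    change (Φ.torsion M).mkQ (x - (ρ x : M)) = _
    rw [map_sub, sub_eq_self]
    exact (Submodule.Quotient.mk_eq_zero _).2 (ρ x).2
  refine ⟨fun X Y _ _ _ _ f hf g => ?_⟩
  obtain ⟨h, hh⟩ := Module.Injective.out f hf (s ∘ₗ g)
  exact ⟨(Φ.torsion M).mkQ ∘ₗ h, fun x => by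
    rw [LinearMap.comp_apply, hh, LinearMap.comp_apply, hs]⟩

/-- A torsion-free module embeds in a torsion-free injective module. -/
lemma exists_mono_injective_of_torsionFree (L : ModuleCat.{u} R)
    (hL : ∀ x ∈ Φ.torsion L, x = 0) :
    ∃ (E : ModuleCat.{u} R) (f : L ⟶ E), Injective E ∧ Mono f ∧ ∀ x ∈ Φ.torsion E, x = 0 := by
  let E := Injective.under L
  have hE : Injective E := Injective.injective_under L
  have : Module.Injective R E := (Module.injective_iff_injective_object R E).2 hE
  have hι : Function.Injective (Injective.ι L) := (ModuleCat.mono_iff_injective _).1 inferInstance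
  refine ⟨ModuleCat.of R (E ⧸ Φ.torsion E),
    Injective.ι L ≫ ModuleCat.ofHom (Φ.torsion E).mkQ,
    (Module.injective_iff_injective_object R _).1 Φ.injective_quotient_torsion, ?_,
    fun x hx => Φ.torsion_quotient_torsion x hx⟩
  rw [ModuleCat.mono_iff_injective, injective_iff_map_eq_zero]
  intro x hx
  obtain ⟨b, hb, h⟩ := (Submodule.Quotient.mk_eq_zero _).1 hx
  refine hL x ⟨b, hb, fun r hr => hι ?_⟩
  rw [map_smul, map_zero]
  exact h r hr

/-- A torsion module embeds in a torsion injective module. -/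
lemma exists_mono_injective_of_torsion (X : ModuleCat.{u} R) (hX : ∀ x : X, x ∈ Φ.torsion X) :
    ∃ (E : ModuleCat.{u} R) (f : X ⟶ E), Injective E ∧ Mono f ∧ ∀ x : E, x ∈ Φ.torsion E := by
  refine ⟨Φ.torsionFunctor.obj (Injective.under X),
    ModuleCat.ofHom (LinearMap.codRestrict _ (Injective.ι X).hom
      fun x => Φ.map_mem_torsion _ x (hX x)), inferInstance, ?_, ?_⟩
  · refine (ModuleCat.mono_iff_injective _).2 fun x y h => ?_
    exact (ModuleCat.mono_iff_injective (Injective.ι X)).1 inferInstance congr(($h).1)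
  · rintro ⟨x, b, hb, h⟩
    exact ⟨b, hb, fun r hr => Subtype.ext (h r hr)⟩

end IdealSystem

/-! ### Exactness and vanishing for the limit of `Ext` -/

namespace Ideal

variable {R : Type u} [CommRing R] (a : Ideal R)

section Postcomp

variable {Y Z : ModuleCat.{u} R} {k i j : ℕ}

lemma extTransition_comp (β : Abelian.Ext Y Z k) (h : i + k = j) (m n : ℕ) (hmn : m ≤ n)
    (x : Abelian.Ext (a.powerQuotients.obj (.op m)) Y i) :
    (a.extTransition i Y m n hmn x).comp β h = a.extTransition j Z m n hmn (x.comp β h) :=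
  Abelian.Ext.comp_assoc (Abelian.Ext.mk₀ _) x β (zero_add i) h (by omega)

/-- Composition with a class in `Ext^k(Y, Z)`, on the direct limits of `Ext`-modules. -/
noncomputable def extLimitPostcomp (β : Abelian.Ext Y Z k) (h : i + k = j) :
    a.ExtLimit i Y →ₗ[R] a.ExtLimit j Z :=
  Module.DirectLimit.map (fun _ => β.postcompOfLinear R _ h) fun m n hmn => by
    ext x
    exact a.extTransition_comp β h m n hmn x

lemma extLimitPostcomp_of (β : Abelian.Ext Y Z k) (h : i + k = j) (n : ℕ)
    (x : Abelian.Ext (a.powerQuotients.obj (.op n)) Y i) :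
    a.extLimitPostcomp β h (Module.DirectLimit.of R ℕ _ _ n x) =
      Module.DirectLimit.of R ℕ _ (a.extTransition j Z) n (x.comp β h) :=
  Module.DirectLimit.map_apply_of _ _ _

end Postcomp

variable {T : ShortComplex (ModuleCat.{u} R)} (hT : T.ShortExact)

include hT

/-- A class that vanishes in the limit already vanishes at some stage `m`, where the long exact
sequence of `Ext` applies. -/
lemma extLimit_exact₂ (i : ℕ) (x : a.ExtLimit i T.X₂)
    (hx : a.extLimitPostcomp (Abelian.Ext.mk₀ T.g) (add_zero i) x = 0) :
    ∃ y, a.extLimitPostcomp (Abelian.Ext.mk₀ T.f) (add_zero i) y = x := by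
  obtain ⟨n, x, rfl⟩ := Module.DirectLimit.exists_of x
  rw [extLimitPostcomp_of] at hx
  obtain ⟨m, hnm, hm⟩ := Module.DirectLimit.of.zero_exact hx
  obtain ⟨y, hy⟩ := Abelian.Ext.covariant_sequence_exact₂ _ hT (a.extTransition i T.X₂ n m hnm x)
    ((a.extTransition_comp _ _ n m hnm x).trans hm)
  refine ⟨Module.DirectLimit.of R ℕ _ _ m y, ?_⟩
  rw [extLimitPostcomp_of, hy, Module.DirectLimit.of_f]

lemma extLimit_extClass_surjective [Injective T.X₂] (i : ℕ) :
    Function.Surjective (a.extLimitPostcomp hT.extClass (rfl : i + 1 = i + 1)) := by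
  intro x
  obtain ⟨n, x, rfl⟩ := Module.DirectLimit.exists_of x
  obtain ⟨y, rfl⟩ := Abelian.Ext.covariant_sequence_exact₁ _ hT x
    (Abelian.Ext.eq_zero_of_injective _) rfl
  exact ⟨Module.DirectLimit.of R ℕ _ _ n y, a.extLimitPostcomp_of _ _ _ _⟩

/-- If every element of `T.X₂` is annihilated by a power of `a`, then a class in the direct limit
of the modules `Hom(R ⧸ a ^ n, T.X₃)` lifts to `T.X₂`. -/
lemma extLimit_postcomp_surjective (h : ∀ x : T.X₂, x ∈ (IdealSystem.powers a).torsion T.X₂) :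
    Function.Surjective
      (a.extLimitPostcomp (i := 0) (Abelian.Ext.mk₀ T.g) (add_zero 0)) := by
  intro x
  obtain ⟨n, x, rfl⟩ := Module.DirectLimit.exists_of x
  obtain ⟨f, rfl⟩ := Abelian.Ext.homEquiv₀.symm.surjective x
  -- A preimage `e` of `f 1` need not be killed by `a ^ n`, but some `a ^ m` kills it; so `f` lifts
  -- after moving to stage `max m n`.
  obtain ⟨e, he⟩ := hT.moduleCat_surjective_g (f (Submodule.Quotient.mk (1 : R)))
  obtain ⟨m, hm⟩ := IdealSystem.mem_torsion_powers.1 (h e)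
  let l : n ≤ max m n := le_max_right m n
  let g : a.powerQuotients.obj (.op (max m n)) ⟶ T.X₂ := ModuleCat.ofHom
    ((a ^ max m n).liftQ (LinearMap.toSpanSingleton R T.X₂ e) fun r hr =>
      hm r (Ideal.pow_le_pow_right (le_max_left m n) hr))
  have hg : g ≫ T.g = a.powerQuotients.map (homOfLE l).op ≫ f := by
    refine ModuleCat.hom_ext (Submodule.linearMap_qext _ (LinearMap.ext_ring ?_))
    change T.g ((1 : R) • e) = f (Submodule.Quotient.mk (1 : R))
    rw [one_smul, he]
  refine ⟨Module.DirectLimit.of R ℕ _ _ (max m n) (Abelian.Ext.mk₀ g), ?_⟩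
  rw [extLimitPostcomp_of, Abelian.Ext.mk₀_comp_mk₀, hg, ← Abelian.Ext.mk₀_comp_mk₀]
  exact Module.DirectLimit.of_f (f := a.extTransition 0 T.X₃) (hij := l)

end Ideal

namespace Ideal

variable {R : Type u} [CommRing R] (a : Ideal R)

/-- Local cohomology of torsion modules vanishes in positive degrees. -/
lemma subsingleton_extLimit_succ [IsNoetherianRing R] (i : ℕ) (X : ModuleCat.{u} R)
    (hX : ∀ x : X, x ∈ (IdealSystem.powers a).torsion X) :
    Subsingleton (a.ExtLimit (i + 1) X) := by
  obtain ⟨E, f, hE, hf, htors⟩ := (IdealSystem.powers a).exists_mono_injective_of_torsion X hX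
  let T := ShortComplex.mk f (Limits.cokernel.π f) (by simp)
  have hT : T.ShortExact :=
    { exact := ShortComplex.exact_of_g_is_cokernel _ (Limits.cokernelIsCokernel f)
      mono_f := hf
      epi_g := inferInstanceAs (Epi (Limits.cokernel.π f)) }
  have : Injective T.X₂ := hE
  have hsurj := a.extLimit_extClass_surjective hT i
  refine subsingleton_of_forall_eq 0 fun x => ?_
  obtain ⟨y, rfl⟩ := hsurj x
  -- In degree one, classes in the limit of `Hom(R ⧸ a ^ n, T.X₃)` lift to the torsion injective
  -- `E`, so the connecting map kills them. In higher degrees the cokernel is again torsion and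
  -- induction applies.
  cases i with
  | zero =>
    obtain ⟨z, rfl⟩ := a.extLimit_postcomp_surjective hT htors y
    obtain ⟨n, z, rfl⟩ := Module.DirectLimit.exists_of z
    rw [extLimitPostcomp_of, extLimitPostcomp_of, Abelian.Ext.comp_assoc_of_second_deg_zero,
      hT.comp_extClass, Abelian.Ext.comp_zero, map_zero]
  | succ i =>
    have := subsingleton_extLimit_succ i T.X₃ fun x => by
      obtain ⟨x, rfl⟩ := hT.moduleCat_surjective_g x
      exact (IdealSystem.powers a).map_mem_torsion T.g.hom x (htors x)
    rw [Subsingleton.elim y 0, map_zero]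

section Eval

variable (M : ModuleCat.{u} R)

/-- Evaluation at `1` of the maps `R ⧸ a → M`. -/
noncomputable def extZeroEval : Abelian.Ext (ModuleCat.of R (R ⧸ a)) M 0 →ₗ[R] M :=
  LinearMap.applyₗ (Submodule.Quotient.mk (1 : R)) ∘ₗ
    (Abelian.Ext.linearEquiv₀.trans ModuleCat.homLinearEquiv).toLinearMap

lemma extZeroEval_mk₀ (f : ModuleCat.of R (R ⧸ a) ⟶ M) :
    a.extZeroEval M (Abelian.Ext.mk₀ f) = f (Submodule.Quotient.mk (1 : R)) :=
  congr(($((Abelian.Ext.linearEquiv₀ (R := R)).apply_symm_apply f)).hom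
    (Submodule.Quotient.mk (1 : R)))

lemma smul_extZeroEval (x : Abelian.Ext (ModuleCat.of R (R ⧸ a)) M 0) (r : R) (hr : r ∈ a) :
    r • a.extZeroEval M x = 0 := by
  obtain ⟨f, rfl⟩ := (Abelian.Ext.linearEquiv₀ (R := R)).symm.surjective x
  rw [Abelian.Ext.linearEquiv₀_symm_apply, extZeroEval_mk₀, ← map_smul,
    ← Submodule.Quotient.mk_smul, smul_eq_mul, mul_one,
    (Submodule.Quotient.mk_eq_zero _).2 hr, map_zero]

lemma extZeroEval_injective : Function.Injective (a.extZeroEval M) := by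
  rw [extZeroEval, LinearMap.coe_comp]
  refine Function.Injective.comp (fun f g h => ?_) (LinearEquiv.injective _)
  exact Submodule.linearMap_qext _ (LinearMap.ext_ring h)

lemma exists_extZeroEval_eq (x : M) (hx : ∀ r ∈ a, r • x = 0) : ∃ y, a.extZeroEval M y = x := by
  refine ⟨Abelian.Ext.mk₀ (ModuleCat.ofHom (a.liftQ (LinearMap.toSpanSingleton R M x) hx)), ?_⟩
  rw [extZeroEval_mk₀]
  exact one_smul R x

/-- The direct limit of `Hom(R ⧸ a ^ n, M)` embeds in the `a`-torsion submodule of `M`. -/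
lemma exists_extLimit_zero_injective :
    ∃ f : a.ExtLimit 0 M →ₗ[R] (IdealSystem.powers a).torsion M, Function.Injective f := by
  let ι (n : ℕ) : Abelian.Ext (a.powerQuotients.obj (.op n)) M 0 →ₗ[R]
      (IdealSystem.powers a).torsion M :=
    LinearMap.codRestrict _ ((a ^ n).extZeroEval M) fun x =>
      IdealSystem.mem_torsion_powers.2 ⟨n, (a ^ n).smul_extZeroEval M x⟩
  refine ⟨Module.DirectLimit.lift R ℕ _ _ ι fun m n h x => Subtype.ext ?_, ?_⟩
  · obtain ⟨f, rfl⟩ := (Abelian.Ext.linearEquiv₀ (R := R)).symm.surjective x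
    refine Eq.trans ?_ ((a ^ m).extZeroEval_mk₀ M f).symm
    exact (congrArg ((a ^ n).extZeroEval M) (Abelian.Ext.mk₀_comp_mk₀ _ _)).trans
      ((a ^ n).extZeroEval_mk₀ M _)
  · rw [injective_iff_map_eq_zero]
    intro x hx
    obtain ⟨n, x, rfl⟩ := Module.DirectLimit.exists_of x
    rw [Module.DirectLimit.lift_of] at hx
    have : x = 0 := (a ^ n).extZeroEval_injective M (congr(($hx).1).trans (map_zero _).symm)
    rw [this, map_zero]

end Eval

end Ideal

/-! ### From `Ext(R ⧸ a, M)` to local cohomology by the Melkersson condition -/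

namespace CategoryTheory.ObjectProperty

variable {R : Type u} [CommRing R] (S : ObjectProperty (ModuleCat.{u} R)) [S.IsSerreClass]
  (a : Ideal R)

/-- The part of `Γ_a(M)` killed by `a` is the image of `Hom(R ⧸ a, Γ_a(M))` under evaluation at `1`,
and this module embeds in `Hom(R ⧸ a, M)`. -/
lemma prop_torsion_of_prop_ext_zero (ha : IsMelkersson S a) (M : ModuleCat.{u} R)
    (h : S (ModuleCat.of R (Abelian.Ext (ModuleCat.of R (R ⧸ a)) M 0))) :
    S (ModuleCat.of R ((IdealSystem.powers a).torsion M)) := by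
  let Γ := (IdealSystem.powers a).torsion M
  refine ha _ (fun x => ?_) ?_
  · obtain ⟨n, hn⟩ := IdealSystem.mem_torsion_powers.1 x.2
    exact ⟨n, fun r hr => Subtype.ext (hn r hr)⟩
  have h₀ : S (ModuleCat.of R (Abelian.Ext (ModuleCat.of R (R ⧸ a)) (ModuleCat.of R Γ) 0)) := by
    have : Mono (ModuleCat.ofHom Γ.subtype) :=
      (ModuleCat.mono_iff_injective _).2 Γ.subtype_injective
    exact S.prop_of_injective
      ((Abelian.Ext.mk₀ (ModuleCat.ofHom Γ.subtype)).postcompOfLinear R _ (add_zero 0))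
      (Abelian.Ext.postcomp_mk₀_injective_of_mono _ _) h
  refine S.prop_of_surjective (LinearMap.codRestrict _ (a.extZeroEval (ModuleCat.of R Γ))
    fun x => (Submodule.mem_torsionBySet_iff _ _).2 fun r => a.smul_extZeroEval _ x r r.2) ?_ h₀
  rintro ⟨x, hx⟩
  obtain ⟨y, hy⟩ := a.exists_extZeroEval_eq (ModuleCat.of R Γ) x fun r hr =>
    (Submodule.mem_torsionBySet_iff _ _).1 hx ⟨r, hr⟩
  exact ⟨y, Subtype.ext hy⟩

/-- If `Ext^i(R ⧸ a, M)` lies in a Serre class satisfying the Melkersson condition for `a` for all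
`i < t`, then so do the local cohomology modules `H^i_a(M)` with `i < t`. -/
theorem prop_extLimit [IsNoetherianRing R] (ha : IsMelkersson S a) (t : ℕ) (M : ModuleCat.{u} R)
    (h : ∀ i < t, S (ModuleCat.of R (Abelian.Ext (ModuleCat.of R (R ⧸ a)) M i))) (i : ℕ)
    (hi : i < t) : S (ModuleCat.of R (a.ExtLimit i M)) := by
  induction i generalizing t M with
  | zero =>
    obtain ⟨f, hf⟩ := a.exists_extLimit_zero_injective M
    exact S.prop_of_injective f hf (S.prop_torsion_of_prop_ext_zero a ha M (h 0 hi))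
  | succ i ih =>
    let N := ModuleCat.of R (R ⧸ a)
    have : Module.Finite R N := inferInstanceAs (Module.Finite R (R ⧸ a))
    let Φ := IdealSystem.powers a
    let Γ := Φ.torsion M
    have hΓ : S (ModuleCat.of R Γ) := S.prop_torsion_of_prop_ext_zero a ha M (h 0 (by omega))
    have hL (j : ℕ) (hj : j < t) : S (ModuleCat.of R (Abelian.Ext N (ModuleCat.of R (M ⧸ Γ)) j)) :=
      S.prop_ext_X₃ Γ.shortExact_mkQ N j (h j hj) (S.prop_ext_of_finite N _ hΓ (j + 1))
    obtain ⟨E, f, hE, hf, hfree⟩ := Φ.exists_mono_injective_of_torsionFree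
      (ModuleCat.of R (M ⧸ Γ)) fun x hx => Φ.torsion_quotient_torsion x hx
    let T := ShortComplex.mk f (Limits.cokernel.π f) (by simp)
    have hT : T.ShortExact :=
      { exact := ShortComplex.exact_of_g_is_cokernel _ (Limits.cokernelIsCokernel f)
        mono_f := hf
        epi_g := inferInstanceAs (Epi (Limits.cokernel.π f)) }
    have : Injective T.X₂ := hE
    -- Degree zero is included: `E` has no `a`-torsion, so `Hom(R ⧸ a, E) = 0`. Hence `Ext^j` into
    -- the cokernel is controlled by `Ext^{j+1}` into `M ⧸ Γ`, for every `j ≥ 0`.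
    have hE' (j : ℕ) : Subsingleton (Abelian.Ext N T.X₂ j) := by
      cases j with
      | zero =>
        refine subsingleton_of_forall_eq 0 fun x => ?_
        refine a.extZeroEval_injective E (Eq.trans ?_ (map_zero _).symm)
        refine hfree _ (IdealSystem.mem_torsion_powers.2 ⟨1, fun r hr => ?_⟩)
        exact a.smul_extZeroEval E x r (by rwa [pow_one] at hr)
      | succ j => exact Abelian.Ext.subsingleton_of_injective N T.X₂ j
    -- The shift costs one degree, hence the bound `t - 1` for the cokernel.
    have hC : S (ModuleCat.of R (a.ExtLimit i T.X₃)) :=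
      ih (t - 1) T.X₃ (fun j hj => S.prop_ext_X₃ hT N j S.prop_of_subsingleton
        (hL (j + 1) (by omega))) (by omega)
    have hLlim : S (ModuleCat.of R (a.ExtLimit (i + 1) T.X₁)) :=
      S.prop_of_surjective _ (a.extLimit_extClass_surjective hT i) hC
    have : Subsingleton (a.ExtLimit (i + 1) (ModuleCat.of R Γ)) :=
      a.subsingleton_extLimit_succ i _ fun x => by
        obtain ⟨b, hb, hx⟩ := x.2
        exact ⟨b, hb, fun r hr => Subtype.ext (hx r hr)⟩
    exact S.prop_of_ker_le _ _ (a.extLimit_exact₂ Γ.shortExact_mkQ (i + 1))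
      S.prop_of_subsingleton hLlim

end CategoryTheory.ObjectProperty

/-! ### Conclusion -/

lemma Module.support_quotient_ideal {R : Type u} [CommRing R] (a : Ideal R) :
    Module.support R (R ⧸ a) = PrimeSpectrum.zeroLocus (a : Set R) := by
  rw [Module.support_eq_zeroLocus, Ideal.annihilator_quotient]

theorem corollary2p6 {R : Type u} [CommRing R] [IsNoetherianRing R] (Φ : IdealSystem R)
    (S : ObjectProperty (ModuleCat.{u} R)) [S.IsSerreClass]
    (hS : ∀ a ∈ Φ, IsMelkersson S a) (M : ModuleCat.{u} R) (t : ℕ) :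
    (∀ a ∈ Φ, ∀ N : ModuleCat.{u} R, Module.Finite R N →
      Module.support R N = PrimeSpectrum.zeroLocus (a : Set R) →
      (∀ i < t, ∀ j < t - i,
        S (ModuleCat.of R (Abelian.Ext N ((Φ.localCohomology i).obj M) j))) →
      ∀ i < t, S ((localCohomology a i).obj M)) ∧
    ((∀ i < t, S ((Φ.localCohomology i).obj M)) →
      ∀ a ∈ Φ, ∀ i < t, S ((localCohomology a i).obj M)) := by
  have h₁ : ∀ a ∈ Φ, ∀ N : ModuleCat.{u} R, Module.Finite R N →
      Module.support R N = PrimeSpectrum.zeroLocus (a : Set R) →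
      (∀ i < t, ∀ j < t - i,
        S (ModuleCat.of R (Abelian.Ext N ((Φ.localCohomology i).obj M) j))) →
      ∀ i < t, S ((localCohomology a i).obj M) := by
    intro a ha N hN hsupp h i hi
    -- `Supp N = V(a)` puts a power of `a` in the annihilator of `N`, and `Φ` has a member inside
    -- that power; so a member of `Φ` kills `N`.
    have hrad : a ≤ (Module.annihilator R N).radical := by
      rw [← PrimeSpectrum.zeroLocus_subset_zeroLocus_iff, ← Module.support_eq_zeroLocus, hsupp]
    obtain ⟨k, hk⟩ := Ideal.exists_pow_le_of_le_radical_of_fg hrad (IsNoetherian.noetherian a)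
    obtain ⟨b, hb, hbk⟩ := Φ.exists_le_pow ha k
    have hExt := S.prop_ext_of_prop_ext_localCohomology Φ M N hb
      (fun r hr => Module.mem_annihilator.1 (hk (hbk hr))) t h
    obtain ⟨f, hf⟩ := a.exists_extLimit_surjective i M
    refine S.prop_of_surjective f hf (S.prop_extLimit a (hS a ha) t M (fun j hj => ?_) i hi)
    exact S.prop_ext_of_support_subset M N t hExt j hj (R ⧸ a)
      (by rw [hsupp, Module.support_quotient_ideal])
  refine ⟨h₁, fun h a ha => h₁ a ha (ModuleCat.of R (R ⧸ a))
    (inferInstanceAs (Module.Finite R (R ⧸ a))) (Module.support_quotient_ideal a) ?_⟩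
  intro i hi j _
  have : Module.Finite R (ModuleCat.of R (R ⧸ a)) := inferInstanceAs (Module.Finite R (R ⧸ a))
  exact S.prop_ext_of_finite _ _ (h i hi) j
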